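/- Let $\Delta\ge 0$, $n,m\in\mathbb N$, and let $\mathcal X^n=C([-\Delta,0];\mathbb R^n)$ carry the supremum norm $\|\cdot\|$, where $|\cdot|$ is the Euclidean norm. Let $f:\mathcal X^n\times\mathbb R^m\to\mathbb R^n$ be Lipschitz on bounded sets with $f(0,0)=0$, and consider the time-delay system $$\dot x(t)=f(x_t,u(t)),\qquad x_t(\tau):=x(t+\tau)\ \text{ for }\tau\in[-\Delta,0],$$ with initial state $x_0\in\mathcal X^n$ and input $u\in\mathcal U^m$, the set of Lebesgue measurable, locally essentially bounded functions $u:\mathbb R_{\ge0}\to\mathbb R^m$. Solutions on $[-\Delta,b)$, $0<b\le+\infty$, are continuous functions which equal $x_0$ on $[-\Delta,0]$, are locally absolutely continuous on $[0,b)$ and satisfy the equation for almost every $t\in[0,b)$. For $V:\mathcal X^n\to\mathbb R_{\ge0}$, $\phi\in\mathcal X^n$ and $w\in\mathbb R^n$ let $$D^+V(\phi,w):=\limsup_{h\to0^+}\frac{V(\phi_{h,w})-V(\phi)}{h}\in[-\infty,+\infty],$$ where, for $s\in[-\Delta,0]$, $\phi_{h,w}(s):=\phi(s+h)$ if $s<-h$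 and $\phi_{h,w}(s):=\phi(0)+(h+s)w$ if $s\ge -h$. A function $\mathbb R_{\ge0}\to\mathbb R_{\ge0}$ is of class $\mathcal N$ if it is continuous, non-decreasing and zero at zero; it is of class $\mathcal K_\infty$ if it is moreover strictly increasing and tends to $+\infty$ at $+\infty$. Assume that there exist $V:\mathcal X^n\to\mathbb R_{\ge0}$ Lipschitz on bounded sets, constants $a,c,\bar c\ge0$, functions $\alpha,\overline\alpha\in\mathcal K_\infty$ and $\gamma\in\mathcal N$ such that, for all $\phi\in\mathcal X^n$ and $v\in\mathbb R^m$, $$\alpha(|\phi(0)|)\le V(\phi)\le\overline\alpha(\|\phi\|)+\bar c,\qquad D^+V(\phi,f(\phi,v))\le a\,\alpha(\|\phi\|)+\gamma(|v|)+c.$$ Then the system is robustly forward complete, that is: 1. for every $x_0\in\mathcal X^n$ and $u\in\mathcal U^m$ there is a solution on $[-\Delta,+\infty)$, and every solution on some $[-\Delta,b)$ with the same $x_0$ and $u$ is a restriction of it; 2. for all $T,r>0$ there is $R\ge 0$ such that, for all $x_0\in\mathcal X^n$ with $\|x_0\|\le r$ and all $u\in\mathcal U^m$ with $\operatorname{ess\,sup}_{t\ge0}|u(t)|\le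 r$, the solution satisfies $|x(t)|\le R$ for all $t\in[0,T]$. -/

import Mathlib

open scoped NNReal ENNReal

noncomputable section

namespace DelaySystem

/-- `ℝⁿ` with its Euclidean norm. -/
abbrev Vec (n : ℕ) : Type := EuclideanSpace ℝ (Fin n)

/-- The space `𝒳ⁿ` of continuous functions `[-Δ, 0] → ℝⁿ`, with the supremum norm. -/
abbrev State (Δ : ℝ≥0) (n : ℕ) : Type := C(Set.Icc (-(Δ : ℝ)) 0, Vec n)

/-- The right end point `0` of `[-Δ, 0]`. -/
def zeroPt (Δ : ℝ≥0) : Set.Icc (-(Δ : ℝ)) 0 :=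
  ⟨0, neg_nonpos.mpr Δ.coe_nonneg, le_refl 0⟩

/-- Class `𝒩`: continuous, non-decreasing, zero at zero. -/
structure ClassN (α : ℝ≥0 → ℝ≥0) : Prop where
  continuous : Continuous α
  monotone : Monotone α
  map_zero : α 0 = 0

/-- Class `𝒦∞`: continuous, (strictly) increasing, zero at zero, and unbounded. -/
structure ClassKInfty (α : ℝ≥0 → ℝ≥0) : Prop where
  continuous : Continuous α
  strictMono : StrictMono α
  map_zero : α 0 = 0
  tendsto : Filter.Tendsto α Filter.atTop Filter.atTop

/-- Lipschitz continuity on every bounded set. -/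
def LipschitzOnBounded {X Y : Type*} [PseudoMetricSpace X] [PseudoMetricSpace Y]
    (g : X → Y) : Prop :=
  ∀ S : Set X, Bornology.IsBounded S → ∃ K : ℝ≥0, LipschitzOnWith K g S

/-- The function `φ_{h,w}` used in Driver's derivative (for `h ≥ 0`). It is written with a clipped
argument, so that its continuity is visible; the two lemmas below give the piecewise form. -/
def driverShift {Δ : ℝ≥0} {n : ℕ} (φ : State Δ n) (w : Vec n) (h : ℝ) : State Δ n where
  toFun s := φ (Set.projIcc (-(Δ : ℝ)) 0 (neg_nonpos.mpr Δ.coe_nonneg) ((s : ℝ) + h))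
    + max (h + (s : ℝ)) 0 • w
  continuous_toFun := by
    refine (φ.continuous.comp (continuous_projIcc.comp ?_)).add ?_ <;> fun_prop

/-- `φ_{h,w}(s) = φ(s + h)` for `s ∈ [-Δ, -h)`. -/
theorem driverShift_of_lt {Δ : ℝ≥0} {n : ℕ} (φ : State Δ n) (w : Vec n) {h : ℝ} (hh : 0 ≤ h)
    (s : Set.Icc (-(Δ : ℝ)) 0) (hs : (s : ℝ) < -h) :
    driverShift φ w h s
      = φ ⟨(s : ℝ) + h, by linarith [s.2.1], by linarith⟩ := by
  have hmem : (s : ℝ) + h ∈ Set.Icc (-(Δ : ℝ)) 0 := ⟨by linarith [s.2.1], by linarith⟩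
  have hmax : max (h + (s : ℝ)) 0 = 0 := max_eq_right (by linarith)
  simp [driverShift, Set.projIcc_of_mem _ hmem, hmax]

/-- `φ_{h,w}(s) = φ(0) + (h + s) w` for `s ∈ [-h, 0] ∩ [-Δ, 0]`. -/
theorem driverShift_of_ge {Δ : ℝ≥0} {n : ℕ} (φ : State Δ n) (w : Vec n) {h : ℝ}
    (s : Set.Icc (-(Δ : ℝ)) 0) (hs : -h ≤ (s : ℝ)) :
    driverShift φ w h s = φ (zeroPt Δ) + (h + (s : ℝ)) • w := by
  have hmax : max (h + (s : ℝ)) 0 = h + (s : ℝ) := max_eq_left (by linarith)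
  have hp : Set.projIcc (-(Δ : ℝ)) 0 (neg_nonpos.mpr Δ.coe_nonneg) ((s : ℝ) + h) = zeroPt Δ :=
    Set.projIcc_of_right_le _ (by linarith)
  simp [driverShift, hmax, hp]

/-- Driver's derivative `D⁺V(φ, w) = limsup_{h → 0⁺} (V(φ_{h,w}) - V(φ)) / h ∈ [-∞, +∞]`. -/
def driverDeriv {Δ : ℝ≥0} {n : ℕ} (V : State Δ n → ℝ≥0) (φ : State Δ n) (w : Vec n) : EReal :=
  Filter.limsup
    (fun h : ℝ => ((((V (driverShift φ w h) : ℝ) - (V φ : ℝ)) / h : ℝ) : EReal))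
    (nhdsWithin 0 (Set.Ioi 0))

/-- The history `x_t ∈ 𝒳ⁿ`, `x_t(τ) = x(t + τ)`. The default value `0` is taken only if `x` is not
continuous on `[t - Δ, t]`, which never happens along a solution. -/
def history (Δ : ℝ≥0) {n : ℕ} (x : ℝ → Vec n) (t : ℝ) : State Δ n :=
  ContinuousMap.mkD (fun τ : Set.Icc (-(Δ : ℝ)) 0 => x (t + (τ : ℝ))) 0

/-- The input set `𝒰ᵐ`: Lebesgue measurable, locally essentially bounded signals on `[0, ∞)`
(values at negative times are irrelevant). -/
structure IsInput {m : ℕ} (u : ℝ → Vec m) : Prop where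
  aemeasurable : AEMeasurable u (MeasureTheory.volume.restrict (Set.Ici 0))
  locally_bounded : ∀ T : ℝ,
    MeasureTheory.eLpNormEssSup u (MeasureTheory.volume.restrict (Set.Icc 0 T)) < ⊤

/-- `‖u‖ = ess sup_{t ≥ 0} |u(t)| ∈ [0, ∞]`. -/
def inputNorm {m : ℕ} (u : ℝ → Vec m) : ℝ≥0∞ :=
  MeasureTheory.eLpNormEssSup u (MeasureTheory.volume.restrict (Set.Ici 0))

/-- `x` is a (Carathéodory) solution of `ẋ(t) = f(x_t, u(t))` on `[-Δ, b)`, `0 < b ≤ +∞`, with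
initial state `x₀`. Only the values of `x` on `[-Δ, b)` matter. -/
structure IsSolution {Δ : ℝ≥0} {n m : ℕ} (f : State Δ n × Vec m → Vec n)
    (x₀ : State Δ n) (u : ℝ → Vec m) (b : EReal) (x : ℝ → Vec n) : Prop where
  pos : 0 < b
  continuousOn : ContinuousOn x {t : ℝ | -(Δ : ℝ) ≤ t ∧ (t : EReal) < b}
  initial : ∀ τ : Set.Icc (-(Δ : ℝ)) 0, x (τ : ℝ) = x₀ τ
  absolutelyContinuous : ∀ T : ℝ, 0 ≤ T → (T : EReal) < b → AbsolutelyContinuousOnInterval x 0 T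
  ode : ∀ᵐ t : ℝ, 0 ≤ t → (t : EReal) < b → HasDerivAt x (f (history Δ x t, u t)) t

/-- Robust forward completeness: for every initial state and input, the corresponding maximal
solution is defined on `[-Δ, +∞)` (there is a global solution, and every solution on some
`[-Δ, b)` is a restriction of it), and for all `T, r > 0` the solutions issued from `‖x₀‖ ≤ r` with
`‖u‖ ≤ r` are bounded on `[0, T]`, uniformly in `x₀` and `u`. -/
def RobustlyForwardComplete {Δ : ℝ≥0} {n m : ℕ} (f : State Δ n × Vec m → Vec n) : Prop :=
  (∀ (x₀ : State Δ n) (u : ℝ → Vec m), IsInput u →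
    ∃ x : ℝ → Vec n, IsSolution f x₀ u ⊤ x ∧
      ∀ (b : EReal) (y : ℝ → Vec n), IsSolution f x₀ u b y →
        ∀ t : ℝ, -(Δ : ℝ) ≤ t → (t : EReal) < b → y t = x t) ∧
  ∀ T r : ℝ, 0 < T → 0 < r → ∃ R : ℝ,
    ∀ (x₀ : State Δ n) (u : ℝ → Vec m), IsInput u → ‖x₀‖ ≤ r → inputNorm u ≤ ENNReal.ofReal r →
      ∀ x : ℝ → Vec n, IsSolution f x₀ u ⊤ x → ∀ t ∈ Set.Icc (0 : ℝ) T, ‖x t‖ ≤ R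

end DelaySystem

end

noncomputable section

namespace DelaySystem

open Set Filter Topology MeasureTheory

variable {Δ : ℝ≥0} {n m : ℕ}

/-! ### Histories -/

/-! The heart is an a priori bound. Where `V` is differentiable along a solution, its derivative is
Driver's derivative, so integration gives `α |x(t)| ≤ V(x_t) ≤ V(x_0) + ∫ (a α‖x_s‖ + γ r + c)`.
Taking the maximum over the delay window yields a Grönwall inequality for `α ‖x_t‖`, and properness
of `α` turns it into a bound depending only on `r` and `T` (`le_gronwallBound_of_driverDeriv_le`).

Integrating the derivative requires `t ↦ V(x_t)` to be absolutely continuous. A merely continuous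
initial state makes `t ↦ x_t` merely continuous, so the bound is first proved for Lipschitz initial
states, where `t ↦ x_t` is Lipschitz, and then passed to the limit
(`exists_lipschitzWith_norm_sub_le`, `norm_history_sub_le_exp`).

The limit needs solutions known in advance to exist on `[0, T]`. Clipping state and input radially
makes the right-hand side bounded and globally Lipschitz, so a contraction gives solutions on `[0,
T]` and Grönwall gives continuous dependence. If the clipping radius exceeds the a priori bound, a
first-exit argument shows that Lipschitz data never reach it (`norm_lt_of_lipschitzWith_initial`).
The limit obeys the same bound, hence solves the original equation. Uniqueness glues the horizons
together and carries the bound to every Carathéodory solution. -/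

theorem history_apply {x : ℝ → Vec n} (hx : Continuous x) (t : ℝ) (τ : Icc (-(Δ : ℝ)) 0) :
    history Δ x t τ = x (t + τ) :=
  ContinuousMap.mkD_apply_of_continuous (by fun_prop)

theorem continuous_history {x : ℝ → Vec n} (hx : Continuous x) : Continuous (history Δ x) := by
  let F : C(ℝ × Icc (-(Δ : ℝ)) 0, Vec n) := ⟨fun p => x (p.1 + p.2), by fun_prop⟩
  have h : history Δ x = F.curry := by
    ext1 t
    ext1 τ
    rw [history_apply hx]
    rfl
  rw [h]
  exact F.curry.continuous

theorem history_congr {x y : ℝ → Vec n} {t : ℝ} (h : ∀ s ∈ Icc (t - Δ) t, x s = y s) :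
    history Δ x t = history Δ y t := by
  unfold history
  congr 1
  funext τ
  exact h _ ⟨by linarith [τ.2.1], by linarith [τ.2.2]⟩

theorem norm_history_le {x : ℝ → Vec n} (hx : Continuous x) {t C : ℝ}
    (h : ∀ s ∈ Icc (t - Δ) t, ‖x s‖ ≤ C) : ‖history Δ x t‖ ≤ C := by
  have : Nonempty (Icc (-(Δ : ℝ)) 0) := ⟨zeroPt Δ⟩
  rw [ContinuousMap.norm_le_of_nonempty]
  intro τ
  rw [history_apply hx]
  exact h _ ⟨by linarith [τ.2.1], by linarith [τ.2.2]⟩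

theorem norm_history_sub_le {x y : ℝ → Vec n} (hx : Continuous x) (hy : Continuous y) {t s C : ℝ}
    (h : ∀ τ ∈ Icc (-(Δ : ℝ)) 0, ‖x (t + τ) - y (s + τ)‖ ≤ C) :
    ‖history Δ x t - history Δ y s‖ ≤ C := by
  have : Nonempty (Icc (-(Δ : ℝ)) 0) := ⟨zeroPt Δ⟩
  rw [ContinuousMap.norm_le_of_nonempty]
  intro τ
  rw [ContinuousMap.sub_apply, history_apply hx, history_apply hy]
  exact h _ τ.2

theorem history_zeroPt {x : ℝ → Vec n} (hx : Continuous x) (t : ℝ) :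
    history Δ x t (zeroPt Δ) = x t := by
  rw [history_apply hx]
  simp [zeroPt]

theorem norm_le_norm_history {x : ℝ → Vec n} (hx : Continuous x) (t : ℝ) :
    ‖x t‖ ≤ ‖history Δ x t‖ := by
  rw [← history_zeroPt (Δ := Δ) hx t]
  exact ContinuousMap.norm_coe_le_norm _ _

/-! ### An integral Grönwall inequality -/

/-- The right-hand side `Y` is differentiable even if `q` is not, and `Y' = k q + d ≤ k Y + d`. The
integral form matters because `q` will be a function of a sup norm. -/
theorem le_gronwallBound_of_le_integral {q : ℝ → ℝ} (hq : Continuous q) {A k d T : ℝ}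
    (hk : 0 ≤ k) (h : ∀ t ∈ Icc 0 T, q t ≤ A + ∫ s in (0 : ℝ)..t, (k * q s + d)) :
    ∀ t ∈ Icc 0 T, q t ≤ gronwallBound A k d t := by
  intro t ht
  set Y : ℝ → ℝ := fun t => A + ∫ s in (0 : ℝ)..t, (k * q s + d) with hY
  have hd : ∀ t, HasDerivAt Y (k * q t + d) t := fun t =>
    ((Continuous.integral_hasStrictDerivAt (by fun_prop) 0 t).hasDerivAt).const_add A
  have := le_gronwallBound_of_liminf_deriv_right_le (f := Y) (f' := fun t => k * q t + d)
    (δ := A) (K := k) (ε := d) (a := 0) (b := T)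
    (fun t _ => (hd t).continuousAt.continuousWithinAt)
    (fun t _ r hr => (hd t).hasDerivWithinAt.liminf_right_slope_le hr)
    (by simp [hY]) (fun t ht => by
      have := h t ⟨ht.1, ht.2.le⟩
      gcongr) t ht
  rw [sub_zero] at this
  exact (h t ht).trans this

/-! ### Radial truncation -/

/-- The radial retraction onto the closed ball of radius `ρ`. -/
def radialClip {E : Type*} [NormedAddCommGroup E] [NormedSpace ℝ E] (ρ : ℝ) (x : E) : E :=
  (ρ / max ρ ‖x‖) • x

section Clip

variable {E : Type*} [NormedAddCommGroup E] [NormedSpace ℝ E] {ρ : ℝ}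

theorem radialClip_of_norm_le (hρ : 0 < ρ) {x : E} (hx : ‖x‖ ≤ ρ) : radialClip ρ x = x := by
  rw [radialClip, max_eq_left hx, div_self hρ.ne', one_smul]

theorem norm_radialClip_le (hρ : 0 < ρ) (x : E) : ‖radialClip ρ x‖ ≤ ρ := by
  have h : 0 < max ρ ‖x‖ := lt_max_of_lt_left hρ
  rw [radialClip, norm_smul, Real.norm_of_nonneg (by positivity), div_mul_eq_mul_div,
    div_le_iff₀ h]
  gcongr
  exact le_max_right _ _

/-- The difference is a shrunken `x - y` plus the change of the scaling factor applied to `y`; each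
is at most `‖x - y‖`. The constant is 2 rather than 1 because the sup norm on states is not
Hilbertian. -/
theorem lipschitzWith_radialClip (hρ : 0 < ρ) : LipschitzWith 2 (radialClip ρ : E → E) := by
  refine LipschitzWith.of_dist_le_mul fun x y => ?_
  have hx : 0 < max ρ ‖x‖ := lt_max_of_lt_left hρ
  have hy : 0 < max ρ ‖y‖ := lt_max_of_lt_left hρ
  have key : radialClip ρ x - radialClip ρ y
      = (ρ / max ρ ‖x‖) • (x - y) + (ρ / max ρ ‖x‖ - ρ / max ρ ‖y‖) • y := by
    simp only [radialClip]
    module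
  have h1 : ‖(ρ / max ρ ‖x‖) • (x - y)‖ ≤ ‖x - y‖ := by
    rw [norm_smul, Real.norm_of_nonneg (by positivity)]
    exact mul_le_of_le_one_left (norm_nonneg _) ((div_le_one hx).2 (le_max_left _ _))
  have h2 : ‖(ρ / max ρ ‖x‖ - ρ / max ρ ‖y‖) • y‖ ≤ ‖x - y‖ := by
    have e : ρ / max ρ ‖x‖ - ρ / max ρ ‖y‖
        = (ρ / max ρ ‖x‖) * ((max ρ ‖y‖ - max ρ ‖x‖) / max ρ ‖y‖) := by
      field_simp
    have hm : |max ρ ‖y‖ - max ρ ‖x‖| ≤ ‖x - y‖ := by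
      calc |max ρ ‖y‖ - max ρ ‖x‖| ≤ max |ρ - ρ| |‖y‖ - ‖x‖| := abs_max_sub_max_le_max _ _ _ _
        _ ≤ ‖x - y‖ := by
          rw [sub_self, abs_zero, norm_sub_rev]
          exact max_le (norm_nonneg _) (abs_norm_sub_norm_le _ _)
    rw [e, norm_smul, Real.norm_eq_abs, abs_mul,
      abs_of_nonneg (by positivity : 0 ≤ ρ / max ρ ‖x‖), abs_div, abs_of_pos hy, mul_assoc,
      div_mul_eq_mul_div |_|]
    have h3 : |max ρ ‖y‖ - max ρ ‖x‖| * ‖y‖ / max ρ ‖y‖ ≤ ‖x - y‖ := by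
      rw [div_le_iff₀ hy]
      gcongr
      exact le_max_right _ _
    exact (mul_le_of_le_one_left (by positivity) ((div_le_one hx).2 (le_max_left _ _))).trans h3
  rw [dist_eq_norm, dist_eq_norm, key]
  refine (norm_add_le _ _).trans ?_
  rw [NNReal.coe_ofNat]
  linarith

end Clip

/-- The right-hand side `f` with state and input truncated to the balls of radius `ρ` and `r`. -/
def truncate (f : State Δ n × Vec m → Vec n) (ρ r : ℝ) (p : State Δ n × Vec m) : Vec n :=
  f (radialClip ρ p.1, radialClip r p.2)

theorem truncate_eq {f : State Δ n × Vec m → Vec n} {ρ r : ℝ} (hρ : 0 < ρ) (hr : 0 < r)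
    {φ : State Δ n} {v : Vec m} (hφ : ‖φ‖ ≤ ρ) (hv : ‖v‖ ≤ r) :
    truncate f ρ r (φ, v) = f (φ, v) := by
  rw [truncate, radialClip_of_norm_le hρ hφ, radialClip_of_norm_le hr hv]

/-- Clipping maps everything into a product of two balls, where `f` has a single Lipschitz constant.
-/
theorem exists_lipschitzWith_truncate {f : State Δ n × Vec m → Vec n} (hf : LipschitzOnBounded f)
    {ρ r : ℝ} (hρ : 0 < ρ) (hr : 0 < r) : ∃ K : ℝ≥0, LipschitzWith K (truncate f ρ r) := by
  obtain ⟨K, hK⟩ := hf (Metric.closedBall 0 ρ ×ˢ Metric.closedBall 0 r)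
    (Metric.isBounded_closedBall.prod Metric.isBounded_closedBall)
  refine ⟨K * 2, lipschitzOnWith_univ.1 (hK.comp (f := fun p : State Δ n × Vec m =>
    (radialClip ρ p.1, radialClip r p.2)) (K := 2) ?_ ?_)⟩
  · refine LipschitzWith.lipschitzOnWith ?_
    have := ((lipschitzWith_radialClip (E := State Δ n) hρ).comp
      (LipschitzWith.prod_fst (β := Vec m))).prodMk
      ((lipschitzWith_radialClip (E := Vec m) hr).comp (LipschitzWith.prod_snd (α := State Δ n)))
    simpa [Function.comp_def] using this
  · intro p _
    simp [norm_radialClip_le hρ, norm_radialClip_le hr]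

theorem exists_norm_truncate_le {f : State Δ n × Vec m → Vec n} (hf : LipschitzOnBounded f)
    {ρ r : ℝ} (hρ : 0 < ρ) (hr : 0 < r) : ∃ M : ℝ≥0, ∀ p, ‖truncate f ρ r p‖ ≤ M := by
  obtain ⟨K, hK⟩ := hf (Metric.closedBall 0 ρ ×ˢ Metric.closedBall 0 r)
    (Metric.isBounded_closedBall.prod Metric.isBounded_closedBall)
  refine ⟨‖f 0‖₊ + K * (max ρ r).toNNReal, fun p => ?_⟩
  have h1 : (radialClip ρ p.1, radialClip r p.2) ∈
      (Metric.closedBall 0 ρ ×ˢ Metric.closedBall 0 r : Set (State Δ n × Vec m)) := by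
    simp [norm_radialClip_le hρ, norm_radialClip_le hr]
  have h2 : (0 : State Δ n × Vec m) ∈
      (Metric.closedBall 0 ρ ×ˢ Metric.closedBall 0 r : Set (State Δ n × Vec m)) := by
    simp [hρ.le, hr.le]
  have h3 := hK.dist_le_mul _ h1 _ h2
  have h4 : ‖(radialClip ρ p.1, radialClip r p.2)‖ ≤ (max ρ r).toNNReal := by
    refine le_trans ?_ (Real.le_coe_toNNReal _)
    exact max_le_max (norm_radialClip_le hρ _) (norm_radialClip_le hr _)
  rw [dist_eq_norm, dist_zero_right] at h3
  have h5 := norm_le_norm_add_norm_sub' (truncate f ρ r p) (f 0)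
  push_cast
  refine h5.trans ?_
  gcongr
  exact h3.trans (by gcongr)

/-! ### Integral solutions -/

/-- `x` satisfies the integrated form of `ẋ(t) = g(x_t, u(t))` on `[0, T]`. -/
structure IsIntegralSolution (g : State Δ n × Vec m → Vec n) (x₀ : State Δ n) (u : ℝ → Vec m)
    (T : ℝ) (x : ℝ → Vec n) : Prop where
  continuous : Continuous x
  initial : ∀ τ : Icc (-(Δ : ℝ)) 0, x τ = x₀ τ
  eq_integral : ∀ t ∈ Icc 0 T, x t = x 0 + ∫ s in (0 : ℝ)..t, g (history Δ x s, u s)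

theorem intervalIntegrable_rhs {g : State Δ n × Vec m → Vec n} (hg : Continuous g) {M : ℝ}
    (hM : ∀ p, ‖g p‖ ≤ M) {u : ℝ → Vec m} (hu : AEMeasurable u) {x : ℝ → Vec n}
    (hx : Continuous x) (a b : ℝ) :
    IntervalIntegrable (fun s => g (history Δ x s, u s)) volume a b := by
  have h1 : AEStronglyMeasurable (fun s => g (history Δ x s, u s)) volume :=
    hg.comp_aestronglyMeasurable
      ((continuous_history hx).aestronglyMeasurable.prodMk hu.aestronglyMeasurable)
  refine (intervalIntegrable_const (c := M)).mono_fun h1.restrict (ae_of_all _ fun s => ?_)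
  exact (hM _).trans (le_abs_self M)

theorem integral_exp_mul_le {l : ℝ} (hl : 0 < l) (t : ℝ) :
    ∫ s in (0 : ℝ)..t, Real.exp (l * s) ≤ Real.exp (l * t) / l := by
  have h : ∀ s ∈ uIcc 0 t, HasDerivAt (fun s => Real.exp (l * s) / l) (Real.exp (l * s)) s := by
    intro s _
    have := (((hasDerivAt_id s).const_mul l).exp).div_const l
    simp only [id, mul_one] at this
    rwa [mul_div_cancel_right₀ _ hl.ne'] at this
  rw [intervalIntegral.integral_eq_sub_of_hasDerivAt h
    (Continuous.intervalIntegrable (by fun_prop) _ _)]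
  have : 0 < Real.exp (l * 0) / l := by positivity
  linarith

/-! ### Existence for globally Lipschitz right-hand sides, by a weighted contraction -/

section Existence

variable (x₀ : State Δ n) {T : ℝ} (hT : 0 ≤ T) (l : ℝ)

/-- The trajectory with initial state `x₀` and with increments `exp (l t) z(t) - z(0)` on `[0, T]`,
constant outside `[-Δ, T]`. -/
def extendWeighted (z : C(Icc 0 T, Vec n)) (t : ℝ) : Vec n :=
  IccExtend (neg_nonpos.mpr Δ.coe_nonneg) x₀ t
    -- Subtracting `z(0)` makes the trajectory match `x₀` at time 0 for every `z`, so the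
    -- contraction can run on the whole space `C([0, T])`.
    + (Real.exp (l * projIcc 0 T hT t) • z (projIcc 0 T hT t) - z ⟨0, le_rfl, hT⟩)

theorem continuous_extendWeighted (z : C(Icc 0 T, Vec n)) :
    Continuous (extendWeighted x₀ hT l z) := by
  unfold extendWeighted
  have h1 : Continuous (IccExtend (neg_nonpos.mpr Δ.coe_nonneg) x₀) := x₀.continuous.Icc_extend'
  have h2 : Continuous (projIcc 0 T hT) := continuous_projIcc
  fun_prop

theorem extendWeighted_of_nonpos (z : C(Icc 0 T, Vec n)) (τ : Icc (-(Δ : ℝ)) 0) :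
    extendWeighted x₀ hT l z τ = x₀ τ := by
  simp [extendWeighted, projIcc_of_le_left hT τ.2.2]

theorem extendWeighted_of_mem (z : C(Icc 0 T, Vec n)) {t : ℝ} (ht : t ∈ Icc 0 T) :
    extendWeighted x₀ hT l z t
      = x₀ (zeroPt Δ) + (Real.exp (l * t) • z ⟨t, ht⟩ - z ⟨0, le_rfl, hT⟩) := by
  simp [extendWeighted, projIcc_of_mem hT ht, IccExtend_of_right_le _ _ ht.1, zeroPt]

/-- The factor 2 counts the increment at `s` and the correction by the value at 0. -/
theorem norm_extendWeighted_sub_le (hl : 0 ≤ l) (z w : C(Icc 0 T, Vec n)) {s t : ℝ}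
    (hst : s ≤ t) (ht : 0 ≤ t) :
    ‖extendWeighted x₀ hT l z s - extendWeighted x₀ hT l w s‖
      ≤ 2 * Real.exp (l * t) * ‖z - w‖ := by
  set p := projIcc 0 T hT s
  have hp : (p : ℝ) ≤ t := by
    simp only [p, coe_projIcc]
    exact max_le ht ((min_le_right _ _).trans hst)
  have e : extendWeighted x₀ hT l z s - extendWeighted x₀ hT l w s
      = Real.exp (l * p) • (z - w) p - (z - w) ⟨0, le_rfl, hT⟩ := by
    simp only [extendWeighted, ContinuousMap.sub_apply, p]
    module
  have h1 : ‖Real.exp (l * p) • (z - w) p‖ ≤ Real.exp (l * t) * ‖z - w‖ := by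
    rw [norm_smul, Real.norm_of_nonneg (Real.exp_nonneg _)]
    gcongr
    exact ContinuousMap.norm_coe_le_norm _ _
  have h2 : ‖(z - w) ⟨0, le_rfl, hT⟩‖ ≤ Real.exp (l * t) * ‖z - w‖ := by
    refine (ContinuousMap.norm_coe_le_norm _ _).trans ?_
    exact le_mul_of_one_le_left (norm_nonneg _) (Real.one_le_exp (by positivity))
  rw [e]
  refine (norm_sub_le _ _).trans ?_
  linarith

/-- Picard iteration for the unknown `z(t) = exp(-l t) (x(t) - x(0))`: the exponential weight makes
the integral operator a contraction on all of `[0, T]` at once. -/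
theorem exists_isIntegralSolution {g : State Δ n × Vec m → Vec n} {K : ℝ≥0}
    (hg : LipschitzWith K g) {M : ℝ} (hM : ∀ p, ‖g p‖ ≤ M) {u : ℝ → Vec m} (hu : AEMeasurable u)
    (hT : 0 ≤ T) : ∃ x, IsIntegralSolution g x₀ u T x := by
  -- The contraction factor is `2K / l`; this choice makes it at most 1/2 and keeps `l > 0` when `K
  -- = 0`.
  set l : ℝ := 4 * K + 1 with hl
  have hl0 : 0 < l := by positivity
  have hc := continuous_extendWeighted x₀ hT l
  have hint : ∀ z a b, IntervalIntegrable
      (fun s => g (history Δ (extendWeighted x₀ hT l z) s, u s)) volume a b := fun z a b =>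
    intervalIntegrable_rhs hg.continuous hM hu (hc z) a b
  let Q : C(Icc 0 T, Vec n) → C(Icc 0 T, Vec n) := fun z =>
    ⟨fun t => Real.exp (-(l * t)) •
      ∫ s in (0 : ℝ)..t, g (history Δ (extendWeighted x₀ hT l z) s, u s), by
      have := intervalIntegral.continuous_primitive (hint z) 0
      have h : Continuous fun t : Icc 0 T => Real.exp (-(l * t)) := by fun_prop
      exact h.smul (this.comp continuous_subtype_val)⟩
  have hQ : ContractingWith (1 / 2) Q := by
    refine ⟨by rw [div_lt_one] <;> norm_num, LipschitzWith.of_dist_le_mul fun z w => ?_⟩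
    have hne : Nonempty (Icc 0 T) := ⟨⟨0, le_rfl, hT⟩⟩
    rw [ContinuousMap.dist_le_iff_of_nonempty]
    rintro ⟨t, ht⟩
    rw [dist_eq_norm]
    change ‖Real.exp (-(l * t)) • (∫ s in (0 : ℝ)..t,
        g (history Δ (extendWeighted x₀ hT l z) s, u s)) - Real.exp (-(l * t)) •
      (∫ s in (0 : ℝ)..t, g (history Δ (extendWeighted x₀ hT l w) s, u s))‖ ≤ _
    rw [← smul_sub, ← intervalIntegral.integral_sub (hint z _ _) (hint w _ _), norm_smul,
      Real.norm_of_nonneg (Real.exp_nonneg _)]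
    have h1 : ‖∫ s in (0 : ℝ)..t, (g (history Δ (extendWeighted x₀ hT l z) s, u s)
        - g (history Δ (extendWeighted x₀ hT l w) s, u s))‖
        ≤ ∫ s in (0 : ℝ)..t, (2 * K * ‖z - w‖) * Real.exp (l * s) := by
      refine intervalIntegral.norm_integral_le_of_norm_le ht.1 (ae_of_all _ fun s hs => ?_)
        (Continuous.intervalIntegrable (by fun_prop) _ _)
      have h2 := hg.dist_le_mul (history Δ (extendWeighted x₀ hT l z) s, u s)
        (history Δ (extendWeighted x₀ hT l w) s, u s)
      rw [dist_prod_same_right, dist_eq_norm, dist_eq_norm] at h2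
      refine h2.trans ?_
      have h3 : ‖history Δ (extendWeighted x₀ hT l z) s - history Δ (extendWeighted x₀ hT l w) s‖
          ≤ 2 * Real.exp (l * s) * ‖z - w‖ :=
        norm_history_sub_le (hc z) (hc w) fun τ hτ =>
          norm_extendWeighted_sub_le x₀ hT l hl0.le z w (by linarith [hτ.2]) hs.1.le
      calc (K : ℝ) * _ ≤ K * (2 * Real.exp (l * s) * ‖z - w‖) := by gcongr
        _ = _ := by ring
    have h4 : ∫ s in (0 : ℝ)..t, (2 * K * ‖z - w‖) * Real.exp (l * s)
        ≤ (2 * K * ‖z - w‖) * (Real.exp (l * t) / l) := by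
      rw [intervalIntegral.integral_const_mul]
      gcongr
      exact integral_exp_mul_le hl0 t
    calc Real.exp (-(l * t)) * _ ≤ Real.exp (-(l * t)) *
          ((2 * K * ‖z - w‖) * (Real.exp (l * t) / l)) := by
          gcongr
          exact h1.trans h4
      _ = (2 * K / l) * ‖z - w‖ := by
          rw [Real.exp_neg]
          field_simp
      _ ≤ ((1 / 2 : ℝ≥0) : ℝ) * dist z w := by
          rw [dist_eq_norm]
          gcongr
          rw [div_le_iff₀ hl0, hl]
          push_cast
          linarith
  set z := hQ.fixedPoint Q
  have hz : ∀ t (ht : t ∈ Icc 0 T), Real.exp (l * t) • z ⟨t, ht⟩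
      = ∫ s in (0 : ℝ)..t, g (history Δ (extendWeighted x₀ hT l z) s, u s) := by
    intro t ht
    have h1 : Q z = z := hQ.fixedPoint_isFixedPt
    have h2 : z ⟨t, ht⟩ = Real.exp (-(l * t)) •
        ∫ s in (0 : ℝ)..t, g (history Δ (extendWeighted x₀ hT l z) s, u s) :=
      (DFunLike.congr_fun h1 ⟨t, ht⟩).symm
    rw [h2, smul_smul, ← Real.exp_add, add_neg_cancel, Real.exp_zero, one_smul]
  -- At the fixed point the correction term of `extendWeighted` disappears.
  have hz0 : z ⟨0, le_rfl, hT⟩ = 0 := by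
    have := hz 0 ⟨le_rfl, hT⟩
    simpa using this
  refine ⟨extendWeighted x₀ hT l z, hc z, extendWeighted_of_nonpos x₀ hT l z, fun t ht => ?_⟩
  rw [extendWeighted_of_mem x₀ hT l z ht, extendWeighted_of_mem x₀ hT l z ⟨le_rfl, hT⟩, hz t ht,
    hz0]
  simp

end Existence

/-! ### Continuous dependence and regularity of integral solutions -/

namespace IsIntegralSolution

variable {g : State Δ n × Vec m → Vec n} {x₀ y₀ : State Δ n} {u : ℝ → Vec m} {T : ℝ}
  {x y : ℝ → Vec n}

theorem apply_zero (hx : IsIntegralSolution g x₀ u T x) : x 0 = x₀ (zeroPt Δ) :=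
  hx.initial (zeroPt Δ)

theorem mono (hx : IsIntegralSolution g x₀ u T x) {S : ℝ} (hS : S ≤ T) :
    IsIntegralSolution g x₀ u S x :=
  ⟨hx.continuous, hx.initial, fun t ht => hx.eq_integral t ⟨ht.1, ht.2.trans hS⟩⟩

theorem congr_ae {g' : State Δ n × Vec m → Vec n} {u' : ℝ → Vec m}
    (hx : IsIntegralSolution g x₀ u T x)
    (h : ∀ᵐ t, t ∈ Icc 0 T → g (history Δ x t, u t) = g' (history Δ x t, u' t)) :
    IsIntegralSolution g' x₀ u' T x := by
  refine ⟨hx.continuous, hx.initial, fun t ht => ?_⟩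
  rw [hx.eq_integral t ht]
  congr 1
  refine intervalIntegral.integral_congr_ae ?_
  filter_upwards [h] with s hs hst
  rw [uIoc_of_le ht.1] at hst
  exact hs ⟨hst.1.le, hst.2.trans ht.2⟩

/-- Grönwall for `‖x_t - y_t‖`. Window points before time 0 see only the initial states; at later
ones the integral up to `t + τ` is at most the integral up to `t`, the integrand being nonnegative.
-/
theorem norm_history_sub_le_exp {K : ℝ≥0} (hg : LipschitzWith K g) {M : ℝ}
    (hM : ∀ p, ‖g p‖ ≤ M) (hu : AEMeasurable u) (hx : IsIntegralSolution g x₀ u T x)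
    (hy : IsIntegralSolution g y₀ u T y) {t : ℝ} (ht : t ∈ Icc 0 T) :
    ‖history Δ x t - history Δ y t‖ ≤ ‖x₀ - y₀‖ * Real.exp (K * t) := by
  have hq : Continuous fun t => ‖history Δ x t - history Δ y t‖ :=
    ((continuous_history (Δ := Δ) hx.continuous).sub
      (continuous_history (Δ := Δ) hy.continuous)).norm
  rw [← gronwallBound_ε0]
  refine le_gronwallBound_of_le_integral hq K.coe_nonneg (fun t ht => ?_) t ht
  have hcK : Continuous fun s => (K : ℝ) * ‖history Δ x s - history Δ y s‖ + 0 := by fun_prop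
  have hpos : ∀ s, 0 ≤ (K : ℝ) * ‖history Δ x s - history Δ y s‖ + 0 := fun s => by positivity
  refine norm_history_sub_le hx.continuous hy.continuous fun τ hτ => ?_
  rcases le_total (t + τ) 0 with h0 | h0
  · have h1 := hx.initial ⟨t + τ, by linarith [hτ.1, ht.1], h0⟩
    have h2 := hy.initial ⟨t + τ, by linarith [hτ.1, ht.1], h0⟩
    simp only at h1 h2
    rw [h1, h2, ← ContinuousMap.sub_apply]
    exact (ContinuousMap.norm_coe_le_norm _ _).trans
      (le_add_of_nonneg_right (intervalIntegral.integral_nonneg ht.1 fun s _ => hpos s))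
  · have hle : t + τ ≤ t := by linarith [hτ.2]
    have hmem : t + τ ∈ Icc 0 T := ⟨h0, hle.trans ht.2⟩
    rw [hx.eq_integral _ hmem, hy.eq_integral _ hmem, add_sub_add_comm,
      ← intervalIntegral.integral_sub
        (intervalIntegrable_rhs hg.continuous hM hu hx.continuous _ _)
        (intervalIntegrable_rhs hg.continuous hM hu hy.continuous _ _)]
    refine (norm_add_le _ _).trans (add_le_add ?_ ?_)
    · rw [hx.apply_zero, hy.apply_zero, ← ContinuousMap.sub_apply]
      exact ContinuousMap.norm_coe_le_norm _ _
    · refine (intervalIntegral.norm_integral_le_of_norm_le h0 (ae_of_all _ fun s _ => ?_)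
        (hcK.intervalIntegrable 0 (t + τ))).trans ?_
      · have h2 := hg.dist_le_mul (history Δ x s, u s) (history Δ y s, u s)
        rwa [dist_prod_same_right, dist_eq_norm, dist_eq_norm, ← add_zero ((K : ℝ) * _)] at h2
      · exact intervalIntegral.integral_mono_interval le_rfl h0 hle
          (ae_of_all _ fun s => hpos s) (hcK.intervalIntegrable 0 t)

theorem ae_hasDerivAt (hg : Continuous g) {M : ℝ} (hM : ∀ p, ‖g p‖ ≤ M) (hu : AEMeasurable u)
    (hx : IsIntegralSolution g x₀ u T x) :
    ∀ᵐ t, t ∈ Icc 0 T → HasDerivAt x (g (history Δ x t, u t)) t := by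
  rcases lt_or_ge T 0 with hT | hT
  · exact ae_of_all _ fun t ht => absurd (ht.1.trans ht.2) (not_le.2 hT)
  -- A two-sided derivative needs the integral formula on a neighbourhood, so both endpoints are
  -- discarded.
  have h0 : ∀ᵐ t : ℝ, t ≠ 0 := by simp [ae_iff, measure_singleton]
  have h1 : ∀ᵐ t : ℝ, t ≠ T := by simp [ae_iff, measure_singleton]
  filter_upwards [(intervalIntegrable_rhs hg hM hu hx.continuous 0 T).ae_hasDerivAt_integral,
    h0, h1] with t ht ht0 htT hmem
  rw [uIcc_of_le hT] at ht
  refine ((ht hmem 0 ⟨le_rfl, hT⟩).const_add (x 0)).congr_of_eventuallyEq ?_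
  filter_upwards [Ioo_mem_nhds (lt_of_le_of_ne hmem.1 ht0.symm) (lt_of_le_of_ne hmem.2 htT)]
    with s hs
  exact hx.eq_integral s ⟨hs.1.le, hs.2.le⟩

theorem lipschitzOnWith (hg : Continuous g) {M : ℝ≥0} (hM : ∀ p, ‖g p‖ ≤ M) (hu : AEMeasurable u)
    (hx : IsIntegralSolution g x₀ u T x) : LipschitzOnWith M x (Icc 0 T) := by
  refine LipschitzOnWith.of_dist_le_mul fun t ht s hs => ?_
  have hi := intervalIntegrable_rhs hg hM hu hx.continuous
  rw [dist_eq_norm, hx.eq_integral t ht, hx.eq_integral s hs, add_sub_add_left_eq_sub,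
    intervalIntegral.integral_interval_sub_left (hi _ _) (hi _ _), Real.dist_eq]
  exact intervalIntegral.norm_integral_le_of_norm_le_const fun s _ => hM _

end IsIntegralSolution

/-! ### Driver's derivative along a trajectory -/

/-- On `s < -h` both functions equal `x(t + h + s)`; elsewhere they differ by the first-order Taylor
remainder of `x` at step `k = h + s`. -/
theorem norm_driverShift_sub_history_le {x : ℝ → Vec n} (hx : Continuous x) {t h C : ℝ}
    {w : Vec n} (hh : 0 ≤ h) (hC : ∀ k ∈ Icc 0 h, ‖x (t + k) - x t - k • w‖ ≤ C) :
    ‖driverShift (history Δ x t) w h - history Δ x (t + h)‖ ≤ C := by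
  have : Nonempty (Icc (-(Δ : ℝ)) 0) := ⟨zeroPt Δ⟩
  rw [ContinuousMap.norm_le_of_nonempty]
  intro s
  rw [ContinuousMap.sub_apply, history_apply hx (t + h)]
  rcases lt_or_ge (s : ℝ) (-h) with hs | hs
  · rw [driverShift_of_lt _ _ hh s hs, history_apply hx]
    have e : t + ((s : ℝ) + h) = t + h + s := by ring
    simp only [e, sub_self, norm_zero]
    exact (norm_nonneg _).trans (hC 0 ⟨le_rfl, hh⟩)
  · rw [driverShift_of_ge _ _ s hs, history_zeroPt hx, norm_sub_rev,
      ← sub_sub, add_assoc]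
    exact hC _ ⟨by linarith, by linarith [s.2.2]⟩

theorem eventually_norm_driverShift_sub_history_le {x : ℝ → Vec n} (hx : Continuous x) {t : ℝ}
    {w : Vec n} (hw : HasDerivAt x w t) {ε : ℝ} (hε : 0 < ε) :
    ∀ᶠ h in 𝓝[>] (0 : ℝ), ‖driverShift (history Δ x t) w h - history Δ x (t + h)‖ ≤ ε * h := by
  obtain ⟨δ, hδ, hb⟩ := Metric.eventually_nhds_iff.1 ((hasDerivAt_iff_isLittleO.1 hw).def hε)
  filter_upwards [Ioo_mem_nhdsGT hδ] with h hh
  refine norm_driverShift_sub_history_le hx hh.1.le fun k hk => ?_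
  have h1 := hb (y := t + k) (by
    rw [Real.dist_eq, add_sub_cancel_left, abs_of_nonneg hk.1]
    exact hk.2.trans_lt hh.2)
  rw [add_sub_cancel_left, Real.norm_of_nonneg hk.1] at h1
  exact h1.trans (by gcongr; exact hk.2)

/-- The linear prolongation in Driver's derivative differs from the true history by `o(h)` in sup
norm, and `V` is Lipschitz near `x_t`, so the two difference quotients have the same limit. -/
theorem driverDeriv_history_eq {V : State Δ n → ℝ≥0} (hV : LipschitzOnBounded V)
    {x : ℝ → Vec n} (hx : Continuous x) {t v' : ℝ} {w : Vec n} (hw : HasDerivAt x w t)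
    (hv : HasDerivAt (fun s => (V (history Δ x s) : ℝ)) v' t) :
    driverDeriv V (history Δ x t) w = (v' : EReal) := by
  -- Radius 2: the true history stays within 1 of `x_t`, and the prolongation within 1 of that
  -- history.
  obtain ⟨K, hK⟩ := hV (Metric.closedBall (history Δ x t) 2) Metric.isBounded_closedBall
  have hdiff : Tendsto (fun h : ℝ => ((V (driverShift (history Δ x t) w h) : ℝ)
      - V (history Δ x (t + h))) / h) (𝓝[>] 0) (𝓝 0) := by
    rw [Metric.tendsto_nhds]
    intro ε hε
    have hc : Tendsto (fun h => history Δ x (t + h)) (𝓝[>] 0) (𝓝 (history Δ x t)) := by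
      have : Continuous fun h => history Δ x (t + h) :=
        (continuous_history hx).comp (continuous_const.add continuous_id)
      simpa using (this.tendsto 0).mono_left nhdsWithin_le_nhds
    -- `K + 1` allows `K = 0`; the factor 1/2 makes the final inequality strict.
    filter_upwards [eventually_norm_driverShift_sub_history_le (Δ := Δ) hx hw
        (ε := ε / (K + 1) / 2) (by positivity),
      eventually_norm_driverShift_sub_history_le (Δ := Δ) hx hw one_pos,
      hc.eventually (Metric.closedBall_mem_nhds _ one_pos),
      Ioo_mem_nhdsGT (one_pos : (0 : ℝ) < 1)] with h h1 h2 h3 h4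
    have h3' : dist (history Δ x (t + h)) (history Δ x t) ≤ 1 := h3
    have hm1 : history Δ x (t + h) ∈ Metric.closedBall (history Δ x t) 2 :=
      h3'.trans one_le_two
    have hm2 : driverShift (history Δ x t) w h ∈ Metric.closedBall (history Δ x t) 2 := by
      refine (dist_triangle _ (history Δ x (t + h)) _).trans ?_
      rw [dist_eq_norm]
      linarith [h4.2]
    have h5 := hK.dist_le_mul _ hm2 _ hm1
    rw [NNReal.dist_eq, dist_eq_norm] at h5
    rw [Real.dist_eq, sub_zero, abs_div, abs_of_pos h4.1, div_lt_iff₀ h4.1]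
    calc _ ≤ (K : ℝ) * (ε / (K + 1) / 2 * h) := h5.trans (by gcongr)
      _ = (K / (K + 1)) * (ε * h) / 2 := by field_simp
      _ ≤ 1 * (ε * h) / 2 := by
        have := h4.1
        gcongr
        rw [div_le_one (by positivity)]
        linarith
      _ < ε * h := by
        have := mul_pos hε h4.1
        linarith
  have hslope : Tendsto (fun h : ℝ => ((V (history Δ x (t + h)) : ℝ) - V (history Δ x t)) / h)
      (𝓝[>] 0) (𝓝 v') := by
    have := (hasDerivAt_iff_tendsto_slope_zero.1 hv).mono_left
      (nhdsWithin_mono 0 (fun h (hh : 0 < h) => hh.ne') : 𝓝[>] (0 : ℝ) ≤ 𝓝[≠] 0)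
    refine this.congr fun h => ?_
    rw [smul_eq_mul, div_eq_inv_mul]
  have hsum := hdiff.add hslope
  rw [zero_add] at hsum
  have hreal : Tendsto (fun h : ℝ => ((V (driverShift (history Δ x t) w h) : ℝ)
      - V (history Δ x t)) / h) (𝓝[>] 0) (𝓝 v') := by
    refine hsum.congr fun h => ?_
    rw [← add_div, sub_add_sub_cancel]
  exact ((continuous_coe_real_ereal.tendsto v').comp hreal).limsup_eq

/-- The hypothesis covers `[-Δ, 0]` as well; this is what forces the detour through Lipschitz
initial states. -/
theorem lipschitzOnWith_history {x : ℝ → Vec n} (hx : Continuous x) {L : ℝ≥0} {T : ℝ}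
    (hL : LipschitzOnWith L x (Icc (-(Δ : ℝ)) T)) :
    LipschitzOnWith L (history Δ x) (Icc 0 T) := by
  refine LipschitzOnWith.of_dist_le_mul fun t ht s hs => ?_
  rw [dist_eq_norm]
  refine norm_history_sub_le hx hx fun τ hτ => ?_
  have := hL.dist_le_mul (t + τ) ⟨by linarith [ht.1, hτ.1], by linarith [ht.2, hτ.2]⟩
    (s + τ) ⟨by linarith [hs.1, hτ.1], by linarith [hs.2, hτ.2]⟩
  rwa [dist_eq_norm, dist_add_right] at this

theorem exists_lipschitzOnWith_comp_history {V : State Δ n → ℝ≥0} (hV : LipschitzOnBounded V)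
    {x : ℝ → Vec n} (hx : Continuous x) {L : ℝ≥0} {T : ℝ}
    (hL : LipschitzOnWith L x (Icc (-(Δ : ℝ)) T)) :
    ∃ K : ℝ≥0, LipschitzOnWith K (fun t => (V (history Δ x t) : ℝ)) (Icc 0 T) := by
  obtain ⟨K, hK⟩ := hV (history Δ x '' Icc 0 T)
    (isCompact_Icc.image (continuous_history hx)).isBounded
  exact ⟨K * L, hK.comp (lipschitzOnWith_history hx hL) (mapsTo_image _ _)⟩

/-! ### The a priori bound -/

theorem le_gronwallBound_of_driverDeriv_le {f : State Δ n × Vec m → Vec n} {V : State Δ n → ℝ≥0}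
    (hV : LipschitzOnBounded V) {a c cbar : ℝ≥0} {α αbar γ : ℝ≥0 → ℝ≥0} (hα : ClassKInfty α)
    (hαbar : ClassKInfty αbar) (hγ : ClassN γ)
    (hbounds : ∀ φ : State Δ n, α ‖φ (zeroPt Δ)‖₊ ≤ V φ ∧ V φ ≤ αbar ‖φ‖₊ + cbar)
    (hderiv : ∀ (φ : State Δ n) (v : Vec m), driverDeriv V φ (f (φ, v))
      ≤ (((a * α ‖φ‖₊ + γ ‖v‖₊ + c : ℝ≥0) : ℝ) : EReal))
    {x : ℝ → Vec n} (hx : Continuous x) {u : ℝ → Vec m} {L r : ℝ≥0} {T : ℝ}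
    (hL : LipschitzOnWith L x (Icc (-(Δ : ℝ)) T))
    (hinit : ∀ s ∈ Icc (-(Δ : ℝ)) 0, ‖x s‖ ≤ r)
    (hode : ∀ᵐ t, t ∈ Icc 0 T → HasDerivAt x (f (history Δ x t, u t)) t ∧ ‖u t‖ ≤ r)
    {t : ℝ} (ht : t ∈ Icc 0 T) :
    (α ‖x t‖₊ : ℝ) ≤ gronwallBound (α r + αbar r + cbar) a (γ r + c) t := by
  set q : ℝ → ℝ := fun t => α ‖history Δ x t‖₊ with hqdef
  have hq : Continuous q :=
    NNReal.continuous_coe.comp (hα.continuous.comp (continuous_history hx).nnnorm)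
  have hq0 : ∀ s, 0 ≤ q s := fun s => NNReal.coe_nonneg _
  set k : ℝ → ℝ := fun s => a * q s + (γ r + c) with hkdef
  have hk : Continuous k := by fun_prop
  have hk0 : ∀ s, 0 ≤ k s := fun s => by
    have := hq0 s
    positivity
  set v : ℝ → ℝ := fun t => V (history Δ x t) with hvdef
  obtain ⟨K, hK⟩ := exists_lipschitzOnWith_comp_history hV hx hL
  have hv0 : v 0 ≤ αbar r + cbar := by
    have h1 : ‖history Δ x 0‖₊ ≤ r := norm_history_le hx fun s hs => hinit s (by simpa using hs)
    have h2 := (hbounds (history Δ x 0)).2.trans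
      (add_le_add_left (hαbar.strictMono.monotone h1) cbar)
    exact_mod_cast h2
  -- `v` is Lipschitz, hence the integral of its derivative, which is Driver's derivative almost
  -- everywhere.
  have hvle : ∀ t ∈ Icc 0 T, v t ≤ αbar r + cbar + ∫ s in (0 : ℝ)..t, k s := by
    intro t ht
    have hac : AbsolutelyContinuousOnInterval v 0 t := by
      refine LipschitzOnWith.absolutelyContinuousOnInterval (K := K) (hK.mono ?_)
      rw [uIcc_of_le ht.1]
      exact Icc_subset_Icc_right ht.2
    have hmono : ∫ s in (0 : ℝ)..t, deriv v s ≤ ∫ s in (0 : ℝ)..t, k s := by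
      refine intervalIntegral.integral_mono_ae_restrict ht.1 hac.intervalIntegrable_deriv
        (hk.intervalIntegrable _ _) ?_
      rw [EventuallyLE, ae_restrict_iff' measurableSet_Icc]
      filter_upwards [hac.ae_differentiableAt, hode] with s hs1 hs2 hs
      obtain ⟨hd, hur⟩ := hs2 ⟨hs.1, hs.2.trans ht.2⟩
      rw [uIcc_of_le ht.1] at hs1
      have h1 := hderiv (history Δ x s) (u s)
      rw [driverDeriv_history_eq hV hx hd (hs1 hs).hasDerivAt, EReal.coe_le_coe_iff] at h1
      refine h1.trans ?_
      have h2 : γ ‖u s‖₊ ≤ γ r := hγ.monotone hur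
      simp only [hkdef, hqdef]
      push_cast
      rw [add_assoc]
      gcongr
    rw [hac.integral_deriv_eq_sub] at hmono
    linarith
  have hle : ∀ t ∈ Icc 0 T, q t ≤ α r + αbar r + cbar + ∫ s in (0 : ℝ)..t, k s := by
    intro t ht
    have hint : 0 ≤ ∫ s in (0 : ℝ)..t, k s := intervalIntegral.integral_nonneg ht.1 fun s _ => hk0 s
    have hne : Nonempty (Icc (-(Δ : ℝ)) 0) := ⟨zeroPt Δ⟩
    -- The sup norm is attained at some `τ`, so `α ‖x_t‖ = α |x(t + τ)|`. If `t + τ ≤ 0` the summand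
    -- `α r` bounds it; otherwise the lower bound on `V` applies at time `t + τ`.
    obtain ⟨τ, -, hτ⟩ := isCompact_univ.exists_isMaxOn (univ_nonempty (α := Icc (-(Δ : ℝ)) 0))
      (history Δ x t).continuous.norm.continuousOn
    have hτn : ‖history Δ x t‖₊ = ‖x (t + τ)‖₊ := by
      apply NNReal.coe_injective
      rw [coe_nnnorm, coe_nnnorm, ← history_apply hx]
      exact le_antisymm ((ContinuousMap.norm_le_of_nonempty _).2 fun σ => hτ (mem_univ σ))
        (ContinuousMap.norm_coe_le_norm _ _)
    simp only [hqdef, hτn]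
    rcases le_total (t + τ) 0 with h0 | h0
    · have h1 : α ‖x (t + τ)‖₊ ≤ α r := hα.strictMono.monotone
        (hinit _ ⟨by linarith [τ.2.1, ht.1], h0⟩)
      have h2 : (α ‖x (t + τ)‖₊ : ℝ) ≤ α r := h1
      have h3 : (0 : ℝ) ≤ αbar r := NNReal.coe_nonneg _
      have h4 : (0 : ℝ) ≤ cbar := NNReal.coe_nonneg _
      linarith
    · have hτt : t + τ ≤ t := by linarith [τ.2.2]
      have h1 := (hbounds (history Δ x (t + τ))).1
      rw [history_zeroPt hx] at h1
      have h2 : (α ‖x (t + τ)‖₊ : ℝ) ≤ v (t + τ) := h1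
      have h3 := hvle (t + τ) ⟨h0, hτt.trans ht.2⟩
      have h4 : ∫ s in (0 : ℝ)..(t + τ), k s ≤ ∫ s in (0 : ℝ)..t, k s :=
        intervalIntegral.integral_mono_interval le_rfl h0 hτt (ae_of_all _ hk0)
          (hk.intervalIntegrable _ _)
      have h5 : (0 : ℝ) ≤ α r := NNReal.coe_nonneg _
      linarith
  refine le_trans ?_ (le_gronwallBound_of_le_integral hq a.coe_nonneg hle t ht)
  exact NNReal.coe_le_coe.2 (hα.strictMono.monotone (norm_le_norm_history hx t))

/-! ### Density of Lipschitz initial states -/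

/-- Averaging the constant extension of `x₀` over `[s, s + h]` gives a function with Lipschitz
constant `2‖x₀‖ / h`, close to `x₀` by uniform continuity. -/
theorem exists_lipschitzWith_norm_sub_le (x₀ : State Δ n) {ε : ℝ} (hε : 0 < ε) :
    ∃ (y₀ : State Δ n) (K : ℝ≥0), LipschitzWith K y₀ ∧ ‖x₀ - y₀‖ ≤ ε := by
  set e : ℝ → Vec n := IccExtend (neg_nonpos.mpr Δ.coe_nonneg) x₀ with he
  have hec : Continuous e := x₀.continuous.Icc_extend'
  have heM : ∀ s, ‖e s‖ ≤ ‖x₀‖ := fun s => ContinuousMap.norm_coe_le_norm _ _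
  have huc : UniformContinuous e :=
    (CompactSpace.uniformContinuous_of_continuous x₀.continuous).comp
      (LipschitzWith.projIcc _).uniformContinuous
  obtain ⟨δ, hδ, hd⟩ := Metric.uniformContinuous_iff.1 huc ε hε
  set h : ℝ := δ / 2 with hh
  have hpos : 0 < h := by positivity
  have hi : ∀ a b, IntervalIntegrable e volume a b := fun a b => hec.intervalIntegrable a b
  set y : ℝ → Vec n := fun s => h⁻¹ • ∫ σ in s..(s + h), e σ with hy
  have hLip : LipschitzWith (Real.toNNReal (h⁻¹ * (2 * ‖x₀‖))) y := by
    refine LipschitzWith.of_dist_le_mul fun s t => ?_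
    have h1 : (∫ σ in s..(s + h), e σ) - ∫ σ in t..(t + h), e σ
        = (∫ σ in s..t, e σ) - ∫ σ in (s + h)..(t + h), e σ :=
      intervalIntegral.integral_interval_sub_interval_comm (hi _ _) (hi _ _) (hi _ _)
    have h2 : ‖∫ σ in s..t, e σ‖ ≤ ‖x₀‖ * dist s t := by
      rw [dist_comm, Real.dist_eq]
      exact intervalIntegral.norm_integral_le_of_norm_le_const fun σ _ => heM σ
    have h3 : ‖∫ σ in (s + h)..(t + h), e σ‖ ≤ ‖x₀‖ * dist s t := by
      rw [dist_comm, Real.dist_eq, ← add_sub_add_right_eq_sub t s h]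
      exact intervalIntegral.norm_integral_le_of_norm_le_const fun σ _ => heM σ
    rw [Real.coe_toNNReal _ (by positivity), dist_eq_norm, hy, ← smul_sub, h1, norm_smul,
      Real.norm_of_nonneg (by positivity), mul_assoc]
    gcongr
    refine (norm_sub_le _ _).trans ?_
    linarith
  refine ⟨⟨fun s => y s, hLip.continuous.comp continuous_subtype_val⟩, _,
    hLip.comp (LipschitzWith.subtype_val _), ?_⟩
  have : Nonempty (Icc (-(Δ : ℝ)) 0) := ⟨zeroPt Δ⟩
  rw [ContinuousMap.norm_le_of_nonempty]
  intro s
  have hs : x₀ s = e s := (IccExtend_val _ _ _).symm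
  have hconst : e s = h⁻¹ • ∫ σ in (s : ℝ)..(s + h), e s := by
    rw [intervalIntegral.integral_const, add_sub_cancel_left, smul_smul, inv_mul_cancel₀ hpos.ne',
      one_smul]
  have hval : (x₀ - ⟨fun s => y s, hLip.continuous.comp continuous_subtype_val⟩ : State Δ n) s
      = h⁻¹ • ∫ σ in (s : ℝ)..(s + h), (e s - e σ) := by
    rw [intervalIntegral.integral_sub intervalIntegrable_const (hi _ _), smul_sub, ← hconst,
      ContinuousMap.sub_apply, hs]
    rfl
  rw [hval, norm_smul, Real.norm_of_nonneg (by positivity)]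
  have hb : ‖∫ σ in (s : ℝ)..(s + h), (e s - e σ)‖ ≤ ε * |(s : ℝ) + h - s| := by
    refine intervalIntegral.norm_integral_le_of_norm_le_const fun σ hσ => ?_
    rw [uIoc_of_le (by linarith)] at hσ
    rw [← dist_eq_norm]
    refine (hd ?_).le
    rw [dist_comm, Real.dist_eq, abs_of_nonneg (by linarith [hσ.1])]
    linarith [hσ.2]
  rw [add_sub_cancel_left, abs_of_pos hpos] at hb
  calc h⁻¹ * _ ≤ h⁻¹ * (ε * h) := by gcongr
    _ = ε := by field_simp

/-! ### Solutions of the untruncated equation -/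

theorem exists_norm_history_le {x : ℝ → Vec n} (hx : Continuous x) (T : ℝ) :
    ∃ C : ℝ, ∀ t ∈ Icc 0 T, ‖history Δ x t‖ ≤ C :=
  isCompact_Icc.exists_bound_of_continuousOn (continuous_history hx).continuousOn

namespace IsIntegralSolution

variable {f : State Δ n × Vec m → Vec n} {x₀ : State Δ n} {u : ℝ → Vec m} {T ρ r : ℝ}
  {x y : ℝ → Vec n}

theorem to_truncate (hx : IsIntegralSolution f x₀ u T x) (hρ : 0 < ρ) (hr : 0 < r)
    (hxρ : ∀ t ∈ Icc 0 T, ‖history Δ x t‖ ≤ ρ) (hur : ∀ᵐ t, t ∈ Icc 0 T → ‖u t‖ ≤ r) :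
    IsIntegralSolution (truncate f ρ r) x₀ u T x := by
  refine hx.congr_ae ?_
  filter_upwards [hur] with t hut ht
  rw [truncate_eq hρ hr (hxρ t ht) (hut ht)]

theorem of_truncate (hx : IsIntegralSolution (truncate f ρ r) x₀ u T x) (hρ : 0 < ρ)
    (hr : 0 < r) (hxρ : ∀ t ∈ Icc 0 T, ‖history Δ x t‖ ≤ ρ)
    (hur : ∀ᵐ t, t ∈ Icc 0 T → ‖u t‖ ≤ r) : IsIntegralSolution f x₀ u T x := by
  refine hx.congr_ae ?_
  filter_upwards [hur] with t hut ht
  rw [truncate_eq hρ hr (hxρ t ht) (hut ht)]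

/-- Both solutions are bounded on `[0, T]`, so for a large radius they solve the same truncated
equation, where continuous dependence with equal data applies. -/
theorem eqOn (hf : LipschitzOnBounded f) (hu : AEMeasurable u) (hr : 0 < r)
    (hur : ∀ᵐ t, t ∈ Icc 0 T → ‖u t‖ ≤ r) (hx : IsIntegralSolution f x₀ u T x)
    (hy : IsIntegralSolution f x₀ u T y) : EqOn x y (Icc (-(Δ : ℝ)) T) := by
  intro t ht
  rcases le_total t 0 with h0 | h0
  · exact (hx.initial ⟨t, ht.1, h0⟩).trans (hy.initial ⟨t, ht.1, h0⟩).symm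
  obtain ⟨C, hC⟩ := exists_norm_history_le (Δ := Δ) hx.continuous T
  obtain ⟨D, hD⟩ := exists_norm_history_le (Δ := Δ) hy.continuous T
  set ρ : ℝ := max 1 (max C D)
  have hρ : 0 < ρ := lt_max_of_lt_left one_pos
  obtain ⟨K, hK⟩ := exists_lipschitzWith_truncate hf hρ hr
  obtain ⟨M, hM⟩ := exists_norm_truncate_le hf hρ hr
  have hx' := hx.to_truncate hρ hr
    (fun t ht => (hC t ht).trans ((le_max_left _ _).trans (le_max_right _ _))) hur
  have hy' := hy.to_truncate hρ hr
    (fun t ht => (hD t ht).trans ((le_max_right _ _).trans (le_max_right _ _))) hur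
  have h := norm_history_sub_le_exp hK hM hu hx' hy' (t := t) ⟨h0, ht.2⟩
  rw [sub_self, norm_zero, zero_mul, norm_le_zero_iff, sub_eq_zero] at h
  rw [← history_zeroPt (Δ := Δ) hx.continuous, h, history_zeroPt hy.continuous]

theorem ae_hasDerivAt_and_lipschitzOnWith (hf : LipschitzOnBounded f) (hu : AEMeasurable u)
    (hr : 0 < r) (hur : ∀ᵐ t, t ∈ Icc 0 T → ‖u t‖ ≤ r) (hx : IsIntegralSolution f x₀ u T x) :
    (∀ᵐ t, t ∈ Icc 0 T → HasDerivAt x (f (history Δ x t, u t)) t) ∧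
      ∃ M : ℝ≥0, LipschitzOnWith M x (Icc 0 T) := by
  obtain ⟨C, hC⟩ := exists_norm_history_le (Δ := Δ) hx.continuous T
  have hρ : 0 < max 1 C := lt_max_of_lt_left one_pos
  have hCρ : ∀ t ∈ Icc 0 T, ‖history Δ x t‖ ≤ max 1 C :=
    fun t ht => (hC t ht).trans (le_max_right _ _)
  obtain ⟨K, hK⟩ := exists_lipschitzWith_truncate hf hρ hr
  obtain ⟨M, hM⟩ := exists_norm_truncate_le hf hρ hr
  have hx' := hx.to_truncate hρ hr hCρ hur
  refine ⟨?_, M, hx'.lipschitzOnWith hK.continuous hM hu⟩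
  filter_upwards [hx'.ae_hasDerivAt hK.continuous hM hu, hur] with t h1 h2 ht
  rw [← truncate_eq (f := f) hρ hr (hCρ t ht) (h2 ht)]
  exact h1 ht

end IsIntegralSolution

theorem lipschitzOnWith_Icc_of_Icc_of_Icc {E : Type*} [PseudoMetricSpace E] {x : ℝ → E}
    {a b c : ℝ} {K L : ℝ≥0} (hab : a ≤ b) (hbc : b ≤ c) (hK : LipschitzOnWith K x (Icc a b))
    (hL : LipschitzOnWith L x (Icc b c)) : LipschitzOnWith (max K L) x (Icc a c) := by
  have hK' := hK.weaken (le_max_left K L)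
  have hL' := hL.weaken (le_max_right K L)
  have key : ∀ s ∈ Icc a c, ∀ t ∈ Icc a c, s ≤ t →
      dist (x s) (x t) ≤ (max K L : ℝ≥0) * dist s t := by
    intro s hs t ht hst
    rcases le_total t b with htb | htb
    · exact hK'.dist_le_mul s ⟨hs.1, hst.trans htb⟩ t ⟨ht.1, htb⟩
    rcases le_total b s with hsb | hsb
    · exact hL'.dist_le_mul s ⟨hsb, hs.2⟩ t ⟨htb, ht.2⟩
    have h1 := hK'.dist_le_mul s ⟨hs.1, hsb⟩ b ⟨hab, le_rfl⟩
    have h2 := hL'.dist_le_mul b ⟨le_rfl, hbc⟩ t ⟨htb, ht.2⟩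
    refine (dist_triangle _ (x b) _).trans ((add_le_add h1 h2).trans_eq ?_)
    rw [← mul_add, Real.dist_eq, Real.dist_eq, Real.dist_eq, abs_of_nonpos (by linarith),
      abs_of_nonpos (by linarith), abs_of_nonpos (by linarith)]
    ring
  refine LipschitzOnWith.of_dist_le_mul fun s hs t ht => ?_
  rcases le_total s t with h | h
  · exact key s hs t ht h
  · rw [dist_comm, dist_comm s]
    exact key t ht s hs h

/-! ### Uniform bounds on a finite horizon -/

section Bound

variable {f : State Δ n × Vec m → Vec n} {V : State Δ n → ℝ≥0} {a c cbar : ℝ≥0}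
  {α αbar γ : ℝ≥0 → ℝ≥0}

/-- While the trajectory stays within `ρ` the truncation is inactive and the a priori bound gives
`‖y‖ < R ≤ ρ`, so there is no first time at which `ρ` is reached. The Lipschitz constant `K` of `y₀`
does not enter `R`. -/
theorem norm_lt_of_lipschitzWith_initial (hf : LipschitzOnBounded f) (hV : LipschitzOnBounded V)
    (hα : ClassKInfty α) (hαbar : ClassKInfty αbar) (hγ : ClassN γ)
    (hbounds : ∀ φ : State Δ n, α ‖φ (zeroPt Δ)‖₊ ≤ V φ ∧ V φ ≤ αbar ‖φ‖₊ + cbar)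
    (hderiv : ∀ (φ : State Δ n) (v : Vec m), driverDeriv V φ (f (φ, v))
      ≤ (((a * α ‖φ‖₊ + γ ‖v‖₊ + c : ℝ≥0) : ℝ) : EReal))
    {r R : ℝ≥0} {T ρ : ℝ} (hr : 0 < r) (hrρ : r ≤ ρ) (hRρ : R ≤ ρ)
    (hR : gronwallBound (α r + αbar r + cbar) a (γ r + c) T < α R)
    {y₀ : State Δ n} {K : ℝ≥0} (hy₀ : LipschitzWith K y₀) (hy₀r : ‖y₀‖ ≤ r)
    {u : ℝ → Vec m} (hu : AEMeasurable u) (hur : ∀ᵐ t, t ∈ Icc 0 T → ‖u t‖ ≤ r)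
    {y : ℝ → Vec n} (hy : IsIntegralSolution (truncate f ρ r) y₀ u T y) :
    ∀ t ∈ Icc 0 T, ‖y t‖ < R := by
  have hr' : (0 : ℝ) < r := hr
  have hρ : 0 < ρ := hr'.trans_le hrρ
  obtain ⟨K', hK'⟩ := exists_lipschitzWith_truncate hf hρ hr'
  obtain ⟨M, hM⟩ := exists_norm_truncate_le hf hρ hr'
  have hinit : ∀ s ∈ Icc (-(Δ : ℝ)) 0, ‖y s‖ ≤ r := fun s hs => by
    rw [hy.initial ⟨s, hs⟩]
    exact (ContinuousMap.norm_coe_le_norm _ _).trans hy₀r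
  have hLip0 : LipschitzOnWith K y (Icc (-(Δ : ℝ)) 0) :=
    LipschitzOnWith.of_dist_le_mul fun s hs t ht => by
      rw [hy.initial ⟨s, hs⟩, hy.initial ⟨t, ht⟩]
      exact hy₀.dist_le_mul ⟨s, hs⟩ ⟨t, ht⟩
  have hmono := gronwallBound_mono (δ := α r + αbar r + cbar) (K := a) (ε := γ r + c)
    (by positivity) (by positivity) a.coe_nonneg
  -- A bound on `[0, τ)` suffices: the equation is needed only almost everywhere, so `τ` itself may
  -- be dropped.
  have step : ∀ τ ∈ Icc 0 T, (∀ s ∈ Ico 0 τ, ‖y s‖ ≤ ρ) → ‖y τ‖ < R := by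
    intro τ hτ hyρ
    have hyτ := hy.mono hτ.2
    have hL := lipschitzOnWith_Icc_of_Icc_of_Icc (neg_nonpos.mpr Δ.coe_nonneg) hτ.1 hLip0
      (hyτ.lipschitzOnWith hK'.continuous hM hu)
    have hne : ∀ᵐ t : ℝ, t ≠ τ := by simp [ae_iff, measure_singleton]
    have hode : ∀ᵐ t, t ∈ Icc 0 τ → HasDerivAt y (f (history Δ y t, u t)) t ∧ ‖u t‖ ≤ r := by
      filter_upwards [hyτ.ae_hasDerivAt hK'.continuous hM hu, hur, hne] with t h1 h2 h3 ht
      have hut := h2 ⟨ht.1, ht.2.trans hτ.2⟩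
      have hhist : ‖history Δ y t‖ ≤ ρ := norm_history_le hy.continuous fun s hs => by
        rcases le_total s 0 with hs0 | hs0
        · exact (hinit s ⟨by linarith [hs.1, ht.1], hs0⟩).trans hrρ
        · exact hyρ s ⟨hs0, hs.2.trans_lt (lt_of_le_of_ne ht.2 h3)⟩
      refine ⟨?_, hut⟩
      rw [← truncate_eq (f := f) hρ hr' hhist hut]
      exact h1 ht
    have h1 := le_gronwallBound_of_driverDeriv_le hV hα hαbar hγ hbounds hderiv hy.continuous hL
      hinit hode ⟨hτ.1, le_rfl⟩
    have h2 : α ‖y τ‖₊ < α R := NNReal.coe_lt_coe.1 ((h1.trans (hmono hτ.2)).trans_lt hR)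
    exact hα.strictMono.lt_iff_lt.1 h2
  have hall : ∀ t ∈ Icc 0 T, ‖y t‖ < ρ := by
    by_contra! hcon
    obtain ⟨t, ht, htρ⟩ := hcon
    have hcl : IsClosed {t | ρ ≤ ‖y t‖} := isClosed_le continuous_const hy.continuous.norm
    obtain ⟨τ, hτ, hleast⟩ := (isCompact_Icc.inter_right hcl).exists_isLeast ⟨t, ht, htρ⟩
    have h1 := step τ hτ.1 fun s hs => by
      by_contra! hlt
      exact absurd (hleast ⟨⟨hs.1, hs.2.le.trans hτ.1.2⟩, hlt.le⟩) (not_le.2 hs.2)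
    exact absurd (h1.trans_le hRρ) (not_lt.2 hτ.2)
  exact fun t ht => step t ht fun s hs => (hall s ⟨hs.1, hs.2.le.trans ht.2⟩).le

theorem exists_bounded_isIntegralSolution (hf : LipschitzOnBounded f) (hV : LipschitzOnBounded V)
    (hα : ClassKInfty α) (hαbar : ClassKInfty αbar) (hγ : ClassN γ)
    (hbounds : ∀ φ : State Δ n, α ‖φ (zeroPt Δ)‖₊ ≤ V φ ∧ V φ ≤ αbar ‖φ‖₊ + cbar)
    (hderiv : ∀ (φ : State Δ n) (v : Vec m), driverDeriv V φ (f (φ, v))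
      ≤ (((a * α ‖φ‖₊ + γ ‖v‖₊ + c : ℝ≥0) : ℝ) : EReal))
    {T r : ℝ} (hT : 0 ≤ T) (hr : 0 < r) :
    ∃ R : ℝ, ∀ (x₀ : State Δ n) (u : ℝ → Vec m), AEMeasurable u → ‖x₀‖ ≤ r →
      (∀ᵐ t, t ∈ Icc 0 T → ‖u t‖ ≤ r) →
      ∃ x, IsIntegralSolution f x₀ u T x ∧ ∀ t ∈ Icc 0 T, ‖x t‖ ≤ R := by
  -- The extra 1 leaves room for Lipschitz approximations of `x₀` at distance at most 1.
  set r' : ℝ≥0 := ⟨r + 1, by positivity⟩ with hr'def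
  have hr'c : (r' : ℝ) = r + 1 := rfl
  have hr' : (0 : ℝ) < r' := by rw [hr'c]; positivity
  obtain ⟨R, hR⟩ := (hα.tendsto.eventually_gt_atTop
    (gronwallBound (α r' + αbar r' + cbar) a (γ r' + c) T).toNNReal).exists
  have hR' : gronwallBound (α r' + αbar r' + cbar) a (γ r' + c) T < α R :=
    (Real.le_coe_toNNReal _).trans_lt (NNReal.coe_lt_coe.2 hR)
  refine ⟨R, fun x₀ u hu hx₀ hur => ?_⟩
  set ρ : ℝ := max r' R
  have hρ : 0 < ρ := lt_max_of_lt_left hr'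
  have hur' : ∀ᵐ t, t ∈ Icc 0 T → ‖u t‖ ≤ r' := by
    filter_upwards [hur] with t h ht
    linarith [h ht]
  obtain ⟨K, hK⟩ := exists_lipschitzWith_truncate hf hρ hr'
  obtain ⟨M, hM⟩ := exists_norm_truncate_le hf hρ hr'
  obtain ⟨x, hx⟩ := exists_isIntegralSolution x₀ hK hM hu hT
  have hbound : ∀ t ∈ Icc 0 T, ‖x t‖ ≤ R := by
    intro t ht
    refine le_of_forall_pos_le_add fun η hη => ?_
    -- The factor `exp(-K t)` cancels the growth in continuous dependence, so the two solutions
    -- differ by at most `η` at time `t`.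
    obtain ⟨y₀, L, hL, hxy⟩ := exists_lipschitzWith_norm_sub_le x₀
      (ε := min 1 (η * Real.exp (-(K * t)))) (by positivity)
    obtain ⟨y, hy⟩ := exists_isIntegralSolution y₀ hK hM hu hT
    have hy₀ : ‖y₀‖ ≤ r' := by
      have := norm_le_norm_add_norm_sub x₀ y₀
      linarith [hxy.trans (min_le_left _ _)]
    have h1 := norm_lt_of_lipschitzWith_initial hf hV hα hαbar hγ hbounds hderiv hr'
      (le_max_left _ _) (le_max_right _ _) hR' hL hy₀ hu hur' hy t ht
    have h2 := hx.norm_history_sub_le_exp hK hM hu hy ht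
    have h3 : ‖x t - y t‖ ≤ ‖history Δ x t - history Δ y t‖ := by
      rw [← history_zeroPt (Δ := Δ) hx.continuous, ← history_zeroPt (Δ := Δ) hy.continuous,
        ← ContinuousMap.sub_apply]
      exact ContinuousMap.norm_coe_le_norm _ _
    have h4 : ‖x₀ - y₀‖ * Real.exp (K * t) ≤ η := by
      calc _ ≤ η * Real.exp (-(K * t)) * Real.exp (K * t) := by
            gcongr
            exact hxy.trans (min_le_right _ _)
        _ = η := by rw [mul_assoc, ← Real.exp_add, neg_add_cancel, Real.exp_zero, mul_one]
    have h5 := norm_le_norm_add_norm_sub' (x t) (y t)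
    linarith
  refine ⟨x, hx.of_truncate hρ hr' (fun t ht => ?_) hur', hbound⟩
  refine norm_history_le hx.continuous fun s hs => ?_
  rcases le_total s 0 with h0 | h0
  · rw [hx.initial ⟨s, by linarith [hs.1, ht.1], h0⟩]
    refine ((ContinuousMap.norm_coe_le_norm _ _).trans hx₀).trans ((?_ : r ≤ r').trans
      (le_max_left _ _))
    linarith
  · exact (hbound s ⟨h0, hs.2.trans ht.2⟩).trans (le_max_right _ _)

end Bound

/-! ### Carathéodory solutions and integral solutions -/

theorem IsSolution.congr_input {f : State Δ n × Vec m → Vec n} {x₀ : State Δ n}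
    {u u' : ℝ → Vec m} {b : EReal} {x : ℝ → Vec n} (hx : IsSolution f x₀ u b x)
    (h : ∀ t, 0 ≤ t → u t = u' t) : IsSolution f x₀ u' b x :=
  ⟨hx.pos, hx.continuousOn, hx.initial, hx.absolutelyContinuous, by
    filter_upwards [hx.ode] with t ht h0 hb
    rw [← h t h0]
    exact ht h0 hb⟩

/-- The solution minus the integral of its right-hand side is absolutely continuous with derivative
zero almost everywhere, hence constant. -/
theorem IsSolution.exists_isIntegralSolution {f : State Δ n × Vec m → Vec n}
    (hf : LipschitzOnBounded f) {x₀ : State Δ n} {u : ℝ → Vec m} {b : EReal} {y : ℝ → Vec n}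
    (hy : IsSolution f x₀ u b y) {T r : ℝ} (hT : 0 ≤ T) (hTb : (T : EReal) < b)
    (hu : AEMeasurable u) (hr : 0 < r) (hur : ∀ᵐ t, t ∈ Icc 0 T → ‖u t‖ ≤ r) :
    ∃ x, IsIntegralSolution f x₀ u T x ∧ ∀ t ∈ Icc (-(Δ : ℝ)) T, x t = y t := by
  have hΔ : -(Δ : ℝ) ≤ 0 := neg_nonpos.mpr Δ.coe_nonneg
  have hΔT : -(Δ : ℝ) ≤ T := hΔ.trans hT
  -- Freezing `y` outside `[-Δ, T]` gives a function continuous on all of `ℝ` with the same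
  -- histories on `[0, T]`.
  set x : ℝ → Vec n := fun t => y (projIcc (-(Δ : ℝ)) T hΔT t) with hxdef
  have hxy : ∀ t ∈ Icc (-(Δ : ℝ)) T, x t = y t := fun t ht => by
    simp only [hxdef, projIcc_of_mem hΔT ht]
  have hyc : ContinuousOn y (Icc (-(Δ : ℝ)) T) := hy.continuousOn.mono fun t ht =>
    ⟨ht.1, lt_of_le_of_lt (EReal.coe_le_coe_iff.2 ht.2) hTb⟩
  have hxc : Continuous x := hyc.comp_continuous (by fun_prop) fun t => Subtype.coe_prop _
  have hhist : ∀ t ∈ Icc 0 T, history Δ x t = history Δ y t := fun t ht =>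
    history_congr fun s hs => hxy s ⟨by linarith [hs.1, ht.1], hs.2.trans ht.2⟩
  obtain ⟨C, hC⟩ := exists_norm_history_le (Δ := Δ) hxc T
  have hρ : 0 < max 1 C := lt_max_of_lt_left one_pos
  have hCρ : ∀ t ∈ Icc 0 T, ‖history Δ x t‖ ≤ max 1 C :=
    fun t ht => (hC t ht).trans (le_max_right _ _)
  obtain ⟨K, hK⟩ := exists_lipschitzWith_truncate hf hρ hr
  obtain ⟨M, hM⟩ := exists_norm_truncate_le hf hρ hr
  have hint := intervalIntegrable_rhs hK.continuous hM hu hxc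
  set I : ℝ → Vec n := fun t =>
    ∫ s in (0 : ℝ)..t, truncate f (max 1 C) r (history Δ x s, u s) with hI
  have hIL : LipschitzWith M I := LipschitzWith.of_dist_le_mul fun t s => by
    rw [dist_eq_norm, hI, intervalIntegral.integral_interval_sub_left (hint _ _) (hint _ _),
      Real.dist_eq]
    exact intervalIntegral.norm_integral_le_of_norm_le_const fun s _ => hM _
  have hac : AbsolutelyContinuousOnInterval (y - I) 0 T :=
    (hy.absolutelyContinuous T hT hTb).sub hIL.lipschitzOnWith.absolutelyContinuousOnInterval
  obtain ⟨A, hA⟩ := hac.const_of_ae_hasDerivAt_zero (by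
    rw [uIcc_of_le hT]
    filter_upwards [hy.ode, hur, (hint 0 T).ae_hasDerivAt_integral] with t h1 h2 h3 ht
    rw [uIcc_of_le hT] at h3
    have h4 := h1 ht.1 (lt_of_le_of_lt (EReal.coe_le_coe_iff.2 ht.2) hTb)
    have h5 := h3 ht 0 ⟨le_rfl, hT⟩
    rw [truncate_eq hρ hr (hCρ t ht) (h2 ht), hhist t ht] at h5
    simpa using h4.sub h5)
  rw [uIcc_of_le hT] at hA
  refine ⟨x, IsIntegralSolution.of_truncate ⟨hxc, fun τ => ?_, fun t ht => ?_⟩ hρ hr hCρ hur, hxy⟩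
  · rw [hxy τ ⟨τ.2.1, τ.2.2.trans hT⟩, hy.initial]
  · have h1 := (hA t ht).trans (hA 0 ⟨le_rfl, hT⟩).symm
    have h2 : I 0 = 0 := by simp [hI]
    rw [Pi.sub_apply, Pi.sub_apply, h2, sub_zero, sub_eq_iff_eq_add] at h1
    rw [hxy t ⟨hΔ.trans ht.1, ht.2⟩, hxy 0 ⟨hΔ, hT⟩, h1]

theorem exists_isSolution_top {f : State Δ n × Vec m → Vec n} (hf : LipschitzOnBounded f)
    {x₀ : State Δ n} {u : ℝ → Vec m} (hu : AEMeasurable u)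
    (hub : ∀ T : ℝ, ∃ r : ℝ, 0 < r ∧ ∀ᵐ t, t ∈ Icc 0 T → ‖u t‖ ≤ r)
    (hex : ∀ T : ℝ, 0 ≤ T → ∃ x, IsIntegralSolution f x₀ u T x) :
    ∃ x, IsSolution f x₀ u ⊤ x := by
  have hΔ : -(Δ : ℝ) ≤ 0 := neg_nonpos.mpr Δ.coe_nonneg
  choose! X hX using hex
  -- At time `t ≥ 0` the solution with horizon `t` is used, and uniqueness makes the horizons agree.
  -- For `t < 0` the absolute value only supplies an admissible horizon.
  set x : ℝ → Vec n := fun t => X |t| t with hxdef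
  have hxX : ∀ T, 0 ≤ T → ∀ t ∈ Icc (-(Δ : ℝ)) T, x t = X T t := by
    intro T hT t ht
    rcases le_total t 0 with h0 | h0
    · exact ((hX _ (abs_nonneg t)).initial ⟨t, ht.1, h0⟩).trans
        ((hX T hT).initial ⟨t, ht.1, h0⟩).symm
    · obtain ⟨r, hr, hur⟩ := hub t
      simp only [hxdef, abs_of_nonneg h0]
      exact (hX t h0).eqOn hf hu hr hur ((hX T hT).mono ht.2) ⟨ht.1, le_rfl⟩
  refine ⟨x, EReal.zero_lt_top, fun t ht => ?_, fun τ => ?_, fun T hT _ => ?_, ?_⟩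
  · have hT : 0 ≤ |t| + 1 := by positivity
    have hlt : t < |t| + 1 := (le_abs_self t).trans_lt (lt_add_one _)
    refine (hX _ hT).continuous.continuousWithinAt.congr_of_eventuallyEq ?_
      (hxX _ hT t ⟨ht.1, hlt.le⟩)
    filter_upwards [self_mem_nhdsWithin, nhdsWithin_le_nhds (Iio_mem_nhds hlt)] with s hs1 hs2
    exact hxX _ hT s ⟨hs1.1, le_of_lt hs2⟩
  · rw [hxX 0 le_rfl τ τ.2, (hX 0 le_rfl).initial]
  · obtain ⟨r, hr, hur⟩ := hub T
    obtain ⟨-, M, hM⟩ := (hX T hT).ae_hasDerivAt_and_lipschitzOnWith hf hu hr hur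
    refine LipschitzOnWith.absolutelyContinuousOnInterval (K := M) ?_
    rw [uIcc_of_le hT]
    intro s hs t ht
    rw [hxX T hT s ⟨hΔ.trans hs.1, hs.2⟩, hxX T hT t ⟨hΔ.trans ht.1, ht.2⟩]
    exact hM hs ht
  -- The exceptional null set depends on the horizon, so only countably many horizons are used.
  · have hall : ∀ᵐ t : ℝ, ∀ N : ℕ, t ∈ Icc 0 (N : ℝ) →
        HasDerivAt (X N) (f (history Δ (X N) t, u t)) t := by
      rw [ae_all_iff]
      intro N
      obtain ⟨r, hr, hur⟩ := hub N
      exact ((hX N N.cast_nonneg).ae_hasDerivAt_and_lipschitzOnWith hf hu hr hur).1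
    have hne : ∀ᵐ t : ℝ, t ≠ 0 := by simp [ae_iff, measure_singleton]
    filter_upwards [hall, hne] with t h1 h2 h0 _
    obtain ⟨N, hN⟩ := exists_nat_gt t
    have h3 : history Δ x t = history Δ (X N) t := history_congr fun s hs =>
      hxX N N.cast_nonneg s ⟨by linarith [hs.1], hs.2.trans hN.le⟩
    rw [h3]
    refine (h1 N ⟨h0, hN.le⟩).congr_of_eventuallyEq ?_
    filter_upwards [Ioo_mem_nhds (lt_of_le_of_ne h0 h2.symm) hN] with s hs
    exact hxX N N.cast_nonneg s ⟨hΔ.trans hs.1.le, hs.2.le⟩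

/-! ### Inputs -/

theorem ae_norm_le_of_eLpNormEssSup_le {u : ℝ → Vec m} {s t : Set ℝ} (hst : t ⊆ s)
    (hs : MeasurableSet s) {r : ℝ} (hr : 0 ≤ r)
    (h : eLpNormEssSup u (volume.restrict s) ≤ ENNReal.ofReal r) :
    ∀ᵐ τ, τ ∈ t → ‖u τ‖ ≤ r := by
  have h1 := (ae_restrict_iff' hs).1 (ae_le_eLpNormEssSup (f := u) (μ := volume.restrict s))
  filter_upwards [h1] with τ hτ hτt
  have h2 := (hτ (hst hτt)).trans h
  rwa [← ofReal_norm, ENNReal.ofReal_le_ofReal_iff hr] at h2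

theorem IsInput.exists_ae_norm_le {u : ℝ → Vec m} (hu : IsInput u) (T : ℝ) :
    ∃ r : ℝ, 0 < r ∧ ∀ᵐ t, t ∈ Icc 0 T → ‖u t‖ ≤ r := by
  set e := eLpNormEssSup u (volume.restrict (Icc 0 T))
  refine ⟨e.toReal + 1, by positivity, ae_norm_le_of_eLpNormEssSup_le le_rfl measurableSet_Icc
    (by positivity) ?_⟩
  calc e = ENNReal.ofReal e.toReal := (ENNReal.ofReal_toReal (hu.locally_bounded T).ne).symm
    _ ≤ _ := ENNReal.ofReal_le_ofReal (by linarith)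

end DelaySystem

end

theorem mainTheorem4 {Δ : ℝ≥0} {n m : ℕ}
    (f : DelaySystem.State Δ n × DelaySystem.Vec m → DelaySystem.Vec n)
    (hf : DelaySystem.LipschitzOnBounded f) (hf0 : f (0, 0) = 0)
    (V : DelaySystem.State Δ n → ℝ≥0) (hV : DelaySystem.LipschitzOnBounded V)
    (a c cbar : ℝ≥0) (α αbar γ : ℝ≥0 → ℝ≥0)
    (hα : DelaySystem.ClassKInfty α) (hαbar : DelaySystem.ClassKInfty αbar)
    (hγ : DelaySystem.ClassN γ)
    (hbounds : ∀ φ : DelaySystem.State Δ n,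
      α ‖φ (DelaySystem.zeroPt Δ)‖₊ ≤ V φ ∧ V φ ≤ αbar ‖φ‖₊ + cbar)
    (hderiv : ∀ (φ : DelaySystem.State Δ n) (v : DelaySystem.Vec m),
      DelaySystem.driverDeriv V φ (f (φ, v))
        ≤ (((a * α ‖φ‖₊ + γ ‖v‖₊ + c : ℝ≥0) : ℝ) : EReal)) :
    DelaySystem.RobustlyForwardComplete f := by
  open DelaySystem Set MeasureTheory in
  -- An input is measurable only on `[0, ∞)`. Extending it by zero makes it almost everywhere
  -- measurable on `ℝ` without affecting solutions.
  have hind : ∀ (u : ℝ → Vec m) (t : ℝ), 0 ≤ t → u t = (Ici 0).indicator u t := fun u t ht =>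
    (indicator_of_mem (mem_Ici.2 ht) u).symm
  have hmeas : ∀ u : ℝ → Vec m, IsInput u → AEMeasurable ((Ici 0).indicator u) := fun u hu =>
    (aemeasurable_indicator_iff measurableSet_Ici).2 hu.aemeasurable
  have hbd : ∀ (u : ℝ → Vec m) (T r : ℝ), (∀ᵐ t, t ∈ Icc 0 T → ‖u t‖ ≤ r) →
      ∀ᵐ t, t ∈ Icc 0 T → ‖(Ici 0).indicator u t‖ ≤ r := fun u T r h => by
    filter_upwards [h] with t ht hmem
    rw [← hind u t hmem.1]
    exact ht hmem
  constructor
  · intro x₀ u hu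
    have hub : ∀ T : ℝ, ∃ r : ℝ, 0 < r ∧ ∀ᵐ t, t ∈ Icc 0 T → ‖(Ici 0).indicator u t‖ ≤ r :=
      fun T => by
        obtain ⟨r, hr, hur⟩ := hu.exists_ae_norm_le T
        exact ⟨r, hr, hbd u T r hur⟩
    obtain ⟨x, hx⟩ := exists_isSolution_top hf (x₀ := x₀) (hmeas u hu) hub fun T hT => by
      obtain ⟨r, hr, hur⟩ := hub T
      obtain ⟨R, hR⟩ := exists_bounded_isIntegralSolution hf hV hα hαbar hγ hbounds hderiv hT
        (r := max r ‖x₀‖) (lt_max_of_lt_left hr)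
      obtain ⟨x, hx, -⟩ := hR x₀ _ (hmeas u hu) (le_max_right _ _) (by
        filter_upwards [hur] with t ht hmem
        exact (ht hmem).trans (le_max_left _ _))
      exact ⟨x, hx⟩
    refine ⟨x, hx.congr_input fun t ht => (hind u t ht).symm, fun b y hy t htΔ htb => ?_⟩
    -- Since `t` may be negative, uniqueness is applied on the horizon `max t 0`.
    have hTb : ((max t 0 : ℝ) : EReal) < b := by
      rcases max_choice t 0 with h | h <;> rw [h]
      · exact htb
      · exact hy.pos
    have hT : 0 ≤ max t 0 := le_max_right _ _
    obtain ⟨r, hr, hur⟩ := hub (max t 0)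
    obtain ⟨y', hy', hyy⟩ := (hy.congr_input (hind u)).exists_isIntegralSolution hf hT hTb
      (hmeas u hu) hr hur
    obtain ⟨x', hx', hxx⟩ := hx.exists_isIntegralSolution hf hT (EReal.coe_lt_top _)
      (hmeas u hu) hr hur
    have ht : t ∈ Icc (-(Δ : ℝ)) (max t 0) := ⟨htΔ, le_max_left _ _⟩
    rw [← hyy t ht, ← hxx t ht]
    exact hy'.eqOn hf (hmeas u hu) hr hur hx' ht
  · intro T r hT hr
    obtain ⟨R, hR⟩ := exists_bounded_isIntegralSolution hf hV hα hαbar hγ hbounds hderiv hT.le hr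
    refine ⟨R, fun x₀ u hu hx₀ hur x hx t ht => ?_⟩
    have hur' := hbd u T r
      (ae_norm_le_of_eLpNormEssSup_le Icc_subset_Ici_self measurableSet_Ici hr.le hur)
    obtain ⟨x', hx', hxx⟩ := (hx.congr_input (hind u)).exists_isIntegralSolution hf hT.le
      (EReal.coe_lt_top _) (hmeas u hu) hr hur'
    -- The bound is known for the constructed solution `z`; uniqueness transfers it to the given
    -- `x`.
    obtain ⟨z, hz, hzR⟩ := hR x₀ _ (hmeas u hu) hx₀ hur'
    have ht' : t ∈ Icc (-(Δ : ℝ)) T := ⟨(neg_nonpos.mpr Δ.coe_nonneg).trans ht.1, ht.2⟩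
    rw [← hxx t ht', hx'.eqOn hf (hmeas u hu) hr hur' hz ht']
    exact hzR t ht
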